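/- **Theorem 3 (One-Sided Avoidance Principle).** Let $n\ge 1$, let $N^n$ and $\tilde N^n$ be closed (compact, without boundary), connected smooth manifolds, let $T,\tilde T\in(0,\infty]$, and let $F:N\times[0,T)\to\mathbb{R}^{n+1}$ and $\tilde F:\tilde N\times[0,\tilde T)\to\mathbb{R}^{n+1}$ be smooth families such that $F_t$ and $\tilde F_t$ are smooth embeddings for each $t$ and such that both are classical solutions of inverse mean curvature flow, that is, the mean curvature $H$ (the sum of the principal curvatures, with the sign for which round spheres have $H>0$) with respect to the outward unit normal $\nu$ is positive everywhere and $$\frac{\partial}{\partial t}F_t(p)=\frac{1}{H(p,t)}\,\nu(p,t),$$ and likewise for $\tilde F$. Write $N_t=F_t(N)$ and $\tilde N_t=\tilde F_t(\tilde N)$, and let $E_t,\tilde E_t\subset\mathbb{R}^{n+1}$ be the open bounded domains enclosed by $N_t$ and $\tilde N_t$. Suppose that $\tilde N_0\subset E_0$. Then $$\overline{\tilde E_t}\subset E_t\qquad\text{for every } t \text{ with } 0\le t<\min\{T,\tilde T\},$$ and the function $t\mapsto \operatorname{dist}(N_t,\tilde N_t)=\inf\{|x-y| : x\in N_t,\ y\in\tilde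 N_t\}$ is non-decreasing on $[0,\min\{T,\tilde T\})$. -/

import Mathlib

open scoped Manifold ContDiff Topology

noncomputable section

namespace IMCF

/-- The region enclosed by a set `S ⊆ ℝᵐ`: the union of the bounded connected components of the
complement of `S`. For a connected closed embedded hypersurface there is exactly one bounded
component. -/
def enclosedRegion {m : ℕ} (S : Set (EuclideanSpace ℝ (Fin m))) :
    Set (EuclideanSpace ℝ (Fin m)) :=
  {x | x ∉ S ∧ Bornology.IsBounded (connectedComponentIn Sᶜ x)}

/-- The distance `inf {|a - b| : a ∈ A, b ∈ B}` between two (nonempty) sets. -/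
def setDist {m : ℕ} (A B : Set (EuclideanSpace ℝ (Fin m))) : ℝ :=
  sInf (Set.image2 dist A B)

/-- The time interval `[0, T)`, where `T` may be `∞`. -/
def timeInterval (T : EReal) : Set ℝ := {t | 0 ≤ t ∧ (t : EReal) < T}

section Hypersurface

variable {n : ℕ} {N : Type*} [TopologicalSpace N] [ChartedSpace (EuclideanSpace ℝ (Fin n)) N]

/-- The local parametrization of `F` in the preferred chart at `p`. -/
def localParam (F : N → EuclideanSpace ℝ (Fin (n + 1))) (p : N) :
    EuclideanSpace ℝ (Fin n) → EuclideanSpace ℝ (Fin (n + 1)) :=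
  F ∘ (extChartAt (𝓡 n) p).symm

/-- The coefficients `g_ij = ⟨∂ᵢF, ∂ⱼF⟩` of the first fundamental form at `p`. -/
def firstForm (F : N → EuclideanSpace ℝ (Fin (n + 1))) (p : N) : Matrix (Fin n) (Fin n) ℝ :=
  Matrix.of fun i j =>
    inner ℝ
      (fderiv ℝ (localParam F p) (extChartAt (𝓡 n) p p) (EuclideanSpace.single i 1))
      (fderiv ℝ (localParam F p) (extChartAt (𝓡 n) p p) (EuclideanSpace.single j 1))

/-- The coefficients `h_ij = -⟨∂ᵢ∂ⱼF, ν⟩` of the second fundamental form at `p` with respect to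
the unit normal `ν`. -/
def secondForm (F : N → EuclideanSpace ℝ (Fin (n + 1))) (p : N)
    (ν : EuclideanSpace ℝ (Fin (n + 1))) : Matrix (Fin n) (Fin n) ℝ :=
  Matrix.of fun i j =>
    -inner ℝ
      (fderiv ℝ (fderiv ℝ (localParam F p)) (extChartAt (𝓡 n) p p)
        (EuclideanSpace.single i 1) (EuclideanSpace.single j 1)) ν

/-- The mean curvature `H = g^{ij} h_ij` at `p` with respect to the unit normal `ν`. The sign is
such that the round sphere of radius `r` has `H = n / r` for the outward normal. -/
def meanCurvature (F : N → EuclideanSpace ℝ (Fin (n + 1))) (p : N)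
    (ν : EuclideanSpace ℝ (Fin (n + 1))) : ℝ :=
  ((firstForm F p)⁻¹ * secondForm F p ν).trace

/-- `ν` is the outward unit normal at `F p` of the hypersurface `F(N)`: it is a unit vector, it is
orthogonal to the tangent space, and it points from the enclosed region to the exterior. -/
structure IsOutwardUnitNormal (F : N → EuclideanSpace ℝ (Fin (n + 1))) (p : N)
    (ν : EuclideanSpace ℝ (Fin (n + 1))) : Prop where
  norm_eq_one : ‖ν‖ = 1
  orthogonal : ∀ v : TangentSpace (𝓡 n) p,
    inner (E := EuclideanSpace ℝ (Fin (n + 1))) ℝ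
      (mfderiv (𝓡 n) 𝓘(ℝ, EuclideanSpace ℝ (Fin (n + 1))) F p v) ν = 0
  inside : ∀ᶠ s : ℝ in 𝓝[>] 0, F p - s • ν ∈ enclosedRegion (Set.range F)
  outside : ∀ᶠ s : ℝ in 𝓝[>] 0, F p + s • ν ∉ closure (enclosedRegion (Set.range F))

/-- `F` is an embedded classical solution of inverse mean curvature flow on `[0, T)`: a smooth
one-parameter family of embeddings `F t : N → ℝⁿ⁺¹` with `H > 0` and `∂F/∂t = ν / H`, where `ν` is
the outward unit normal (the time derivative at `t = 0` is one-sided). -/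
structure IsEmbeddedSolution (F : ℝ → N → EuclideanSpace ℝ (Fin (n + 1))) (T : EReal) :
    Prop where
  smooth : ContMDiffOn ((𝓡 n).prod 𝓘(ℝ, ℝ)) 𝓘(ℝ, EuclideanSpace ℝ (Fin (n + 1))) ∞
    (fun x : N × ℝ => F x.2 x.1) (Set.univ ×ˢ timeInterval T)
  immersion : ∀ t ∈ timeInterval T, ∀ p : N,
    Function.Injective (mfderiv (𝓡 n) 𝓘(ℝ, EuclideanSpace ℝ (Fin (n + 1))) (F t) p)
  embedding : ∀ t ∈ timeInterval T, Topology.IsEmbedding (F t)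
  flow : ∀ t ∈ timeInterval T, ∀ p : N, ∃ ν : EuclideanSpace ℝ (Fin (n + 1)),
    IsOutwardUnitNormal (F t) p ν ∧ 0 < meanCurvature (F t) p ν ∧
      HasDerivWithinAt (fun s => F s p) ((meanCurvature (F t) p ν)⁻¹ • ν) (timeInterval T) t

end Hypersurface

end IMCF

end

/-! Suppose the surfaces are nested at time `t`, and let `x = F t p`, `y = F' t q` realize their
distance. Both tangent spaces are orthogonal to `x - y`, and both outward normals equal `ν = (x -
y)/|x - y|`: the outer one points away from the enclosed point `y`, the inner one towards the
exterior point `x`. Moving both points with a common velocity and using minimality to second order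
gives `H(p) ≤ H'(q)` (`meanCurvature_le_of_isMin`). Inverse mean curvature flow therefore moves `x`
along `ν` at least as fast as `y`, and `|F s p - F' s q|²` has nonnegative derivative at `t`. This
quantity bounds the squared distance from above and agrees with it at `t`, so a Dini derivative
argument makes the distance non-decreasing as long as nesting persists
(`setDist_le_of_forall_subset`).

Nesting persists without any stability theorem for enclosed regions. At a closest pair with `x ≠ y`,
the velocity `ν/H` of the outer surface has positive inner product with `x - y` if `y` is enclosed,
and negative if it is not (`inner_velocity_of_isMin`). This inner product is continuous in space and
time, and closest pairs form a compact set over a compact time interval. So non-nested times form a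
closed set. At its first element `τ > 0` the distance is still at least the initial one, hence
positive, and a limit of closest pairs from earlier times has nonnegative inner product. The strict
negative sign at `τ` contradicts this. -/

noncomputable section

namespace IMCF

/-! ### Enclosed regions and connected components of complements. -/

section Topology

variable {m : ℕ} {S S' : Set (EuclideanSpace ℝ (Fin m))}

/-- Points joined by a preconnected set disjoint from `S` are simultaneously enclosed by `S`. -/
theorem mem_enclosedRegion_iff_of_isPreconnected {C : Set (EuclideanSpace ℝ (Fin m))}
    (hC : IsPreconnected C) (hCS : C ⊆ Sᶜ) {a b : EuclideanSpace ℝ (Fin m)} (ha : a ∈ C)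
    (hb : b ∈ C) : a ∈ enclosedRegion S ↔ b ∈ enclosedRegion S := by
  have h : connectedComponentIn Sᶜ a = connectedComponentIn Sᶜ b :=
    connectedComponentIn_eq (hC.subset_connectedComponentIn ha hCS hb)
  have ha' : a ∉ S := hCS ha
  have hb' : b ∉ S := hCS hb
  simp only [enclosedRegion, Set.mem_ofPred_eq, h, ha', hb']

/-- Components of the open set `Sᶜ` are open, so a limit point off `S` shares its component with an
enclosed point. -/
theorem closure_enclosedRegion_subset (hS : IsClosed S) :
    closure (enclosedRegion S) ⊆ enclosedRegion S ∪ S := by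
  intro x hx
  by_cases hxS : x ∈ S
  · exact Or.inr hxS
  · left
    have ho : IsOpen (connectedComponentIn Sᶜ x) := hS.isOpen_compl.connectedComponentIn
    have hxm : x ∈ connectedComponentIn Sᶜ x := mem_connectedComponentIn hxS
    obtain ⟨z, hz, hzE⟩ := mem_closure_iff.1 hx _ ho hxm
    exact (mem_enclosedRegion_iff_of_isPreconnected isPreconnected_connectedComponentIn
      (connectedComponentIn_subset _ _) hz hxm).1 hzE

/-- If `S'` lies in the region enclosed by `S`, then so does the closure of the region enclosed by
`S'`, provided that from each point of `S` one can leave the region enclosed by `S`. -/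
theorem closure_enclosedRegion_subset_enclosedRegion (hS' : IsClosed S')
    (h : S' ⊆ enclosedRegion S)
    (hout : ∀ x ∈ S, ∃ ν, ∀ᶠ s : ℝ in 𝓝[>] 0, x + s • ν ∉ S ∪ enclosedRegion S) :
    closure (enclosedRegion S') ⊆ enclosedRegion S := by
  -- The component of `x` in `Sᶜ` misses `S'`, since a common point would make `x` enclosed by `S`.
  -- It thus lies in the component of `x` in `S'ᶜ`, and would be bounded if the latter were.
  have key : ∀ x, x ∉ S → x ∉ enclosedRegion S → x ∉ enclosedRegion S' := by
    intro x hxS hxE hx'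
    refine hxE ⟨hxS, hx'.2.subset ?_⟩
    refine isPreconnected_connectedComponentIn.subset_connectedComponentIn
      (mem_connectedComponentIn hxS) fun z hz hzS' => hxE ?_
    exact (mem_enclosedRegion_iff_of_isPreconnected isPreconnected_connectedComponentIn
      (connectedComponentIn_subset _ _) hz (mem_connectedComponentIn hxS)).1 (h hzS')
  refine (closure_enclosedRegion_subset hS').trans (Set.union_subset (fun x hx => ?_) h)
  by_contra hxE
  by_cases hxS : x ∈ S
  -- For `x` on `S`, a short segment leaving along `ν` avoids `S'` and ends at a point to which
  -- `key` applies.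
  · obtain ⟨ν, hν⟩ := hout x hxS
    obtain ⟨ε, hε, hεs⟩ := mem_nhdsGT_iff_exists_Ioc_subset.1 hν
    have hε0 : (0 : ℝ) < ε := hε
    have hC : IsPreconnected ((fun s : ℝ => x + s • ν) '' Set.Icc 0 ε) :=
      isPreconnected_Icc.image _ (by fun_prop)
    have hCS : (fun s : ℝ => x + s • ν) '' Set.Icc 0 ε ⊆ S'ᶜ := by
      rintro _ ⟨s, hs, rfl⟩ hsS
      rcases hs.1.eq_or_lt with rfl | hs0
      · exact (h hsS).1 (by simpa using hxS)
      · exact hεs ⟨hs0, hs.2⟩ (Or.inr (h hsS))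
    have h0 : x ∈ (fun s : ℝ => x + s • ν) '' Set.Icc 0 ε := ⟨0, ⟨le_rfl, hε0.le⟩, by simp⟩
    have h1 : x + ε • ν ∈ (fun s : ℝ => x + s • ν) '' Set.Icc 0 ε := ⟨ε, ⟨hε0.le, le_rfl⟩, rfl⟩
    have hn : x + ε • ν ∉ S ∪ enclosedRegion S := hεs ⟨hε0, le_rfl⟩
    exact key _ (fun hh => hn (Or.inl hh)) (fun hh => hn (Or.inr hh))
      ((mem_enclosedRegion_iff_of_isPreconnected hC hCS h0 h1).1 hx)
  · exact key x hxS hxE hx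

end Topology

/-! ### Orientation of the outward normal. -/

section Normal

/-- Unit vectors orthogonal to the same hyperplane agree up to sign. -/
theorem eq_or_eq_neg_of_orthogonal {n : ℕ}
    {A : EuclideanSpace ℝ (Fin n) →ₗ[ℝ] EuclideanSpace ℝ (Fin (n + 1))}
    (hA : Function.Injective A) {ν w : EuclideanSpace ℝ (Fin (n + 1))} (hν : ‖ν‖ = 1)
    (hw : ‖w‖ = 1) (hAν : ∀ v, inner ℝ (A v) ν = 0) (hAw : ∀ v, inner ℝ (A v) w = 0) :
    w = ν ∨ w = -ν := by
  have hr : Module.finrank ℝ (LinearMap.range A) = n := by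
    rw [LinearMap.finrank_range_of_inj hA, finrank_euclideanSpace_fin]
  have hK : Module.finrank ℝ (LinearMap.range A)ᗮ = 1 := by
    have := (LinearMap.range A).finrank_add_finrank_orthogonal
    rw [hr, finrank_euclideanSpace_fin] at this
    omega
  have mem : ∀ z, (∀ v, inner ℝ (A v) z = 0) → z ∈ (LinearMap.range A)ᗮ := by
    intro z hz
    rw [Submodule.mem_orthogonal]
    rintro _ ⟨v, rfl⟩
    exact hz v
  have hν0 : (⟨ν, mem ν hAν⟩ : (LinearMap.range A)ᗮ) ≠ 0 := by
    intro h0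
    have : ν = 0 := congrArg Subtype.val h0
    simp [this] at hν
  obtain ⟨c, hc⟩ := (finrank_eq_one_iff_of_nonzero' _ hν0).1 hK ⟨w, mem w hAw⟩
  have hc' : c • ν = w := congrArg Subtype.val hc
  have habs : |c| = 1 := by
    have := hw
    rw [← hc', norm_smul, hν, mul_one, Real.norm_eq_abs] at this
    exact this
  rcases eq_or_eq_neg_of_abs_eq habs with rfl | rfl
  · left; simpa using hc'.symm
  · right; simpa using hc'.symm

variable {n : ℕ} {N : Type*} [TopologicalSpace N] [ChartedSpace (EuclideanSpace ℝ (Fin n)) N]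
  {F : N → EuclideanSpace ℝ (Fin (n + 1))} {p : N} {ν : EuclideanSpace ℝ (Fin (n + 1))}

theorem mfderiv_eq_fderiv_localParam
    (hF : MDifferentiableAt (𝓡 n) 𝓘(ℝ, EuclideanSpace ℝ (Fin (n + 1))) F p) :
    mfderiv (𝓡 n) 𝓘(ℝ, EuclideanSpace ℝ (Fin (n + 1))) F p =
      fderiv ℝ (localParam F p) (extChartAt (𝓡 n) p p) := by
  refine hF.mfderiv.trans ?_
  rw [ModelWithCorners.range_eq_univ, fderivWithin_univ]
  rfl

/-- If the half-open segment from `y` to the point `F p` avoids the hypersurface and is orthogonal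
to it, then the outward normal at `F p` points away from `y` exactly when `y` is enclosed. -/
theorem IsOutwardUnitNormal.norm_smul_eq (hν : IsOutwardUnitNormal F p ν)
    (hinj : Function.Injective
      (mfderiv (𝓡 n) 𝓘(ℝ, EuclideanSpace ℝ (Fin (n + 1))) F p))
    {y : EuclideanSpace ℝ (Fin (n + 1))} (hy : F p ≠ y)
    (hseg : ∀ s ∈ Set.Ioc (0 : ℝ) 1, F p + s • (y - F p) ∉ Set.range F)
    (horth : ∀ v : TangentSpace (𝓡 n) p,
      inner (E := EuclideanSpace ℝ (Fin (n + 1))) ℝ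
        (mfderiv (𝓡 n) 𝓘(ℝ, EuclideanSpace ℝ (Fin (n + 1))) F p v) (F p - y) = 0) :
    (y ∈ enclosedRegion (Set.range F) → ‖F p - y‖ • ν = F p - y) ∧
      (y ∉ enclosedRegion (Set.range F) → ‖F p - y‖ • ν = -(F p - y)) := by
  have hpos : 0 < ‖F p - y‖ := norm_pos_iff.2 (sub_ne_zero.2 hy)
  have hC : IsPreconnected ((fun s : ℝ => F p + s • (y - F p)) '' Set.Ioc 0 1) :=
    isPreconnected_Ioc.image _ (by fun_prop)
  have hCS : (fun s : ℝ => F p + s • (y - F p)) '' Set.Ioc 0 1 ⊆ (Set.range F)ᶜ := by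
    rintro _ ⟨s, hs, rfl⟩
    exact hseg s hs
  have h1 : y ∈ (fun s : ℝ => F p + s • (y - F p)) '' Set.Ioc 0 1 :=
    ⟨1, ⟨one_pos, le_rfl⟩, by simp⟩
  set w := ‖F p - y‖⁻¹ • (F p - y) with hw
  have hw1 : ‖w‖ = 1 := by
    rw [hw, norm_smul, norm_inv, norm_norm, inv_mul_cancel₀ hpos.ne']
  have hyw : F p - y = ‖F p - y‖ • w := by
    rw [hw, smul_smul, mul_inv_cancel₀ hpos.ne', one_smul]
  have hcase : w = ν ∨ w = -ν := by
    refine eq_or_eq_neg_of_orthogonal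
      (A := (mfderiv (𝓡 n) 𝓘(ℝ, EuclideanSpace ℝ (Fin (n + 1))) F p).toLinearMap) hinj
      hν.norm_eq_one hw1 hν.orthogonal fun v => ?_
    rw [hw, inner_smul_right]
    exact mul_eq_zero_of_right _ (horth v)
  -- For small `s` the point `F p - s • w` lies on the segment towards `y`, which avoids the
  -- surface. Comparing with `inside` and `outside` fixes the sign in `w = ±ν`.
  have hsmall : ∀ᶠ s : ℝ in 𝓝[>] 0,
      (F p - s • w ∈ enclosedRegion (Set.range F) ↔ y ∈ enclosedRegion (Set.range F)) := by
    filter_upwards [Ioc_mem_nhdsGT hpos] with s hs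
    refine mem_enclosedRegion_iff_of_isPreconnected hC hCS
      ⟨s / ‖F p - y‖, ⟨div_pos hs.1 hpos, (div_le_one hpos).2 hs.2⟩, ?_⟩ h1
    simp only [hw, smul_smul, div_eq_mul_inv, ← neg_sub (F p) y, smul_neg, ← sub_eq_add_neg]
  constructor
  · intro hyE
    rcases hcase with h | h
    · rw [← h, ← hyw]
    · exfalso
      obtain ⟨s, hs, hs'⟩ := (hsmall.and hν.outside).exists
      refine hs' (subset_closure ?_)
      have := hs.2 hyE
      rwa [h, smul_neg, sub_neg_eq_add] at this
  · intro hyE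
    rcases hcase with h | h
    · exfalso
      obtain ⟨s, hs, hs'⟩ := (hsmall.and hν.inside).exists
      rw [h] at hs
      exact hyE (hs.1 hs')
    · rw [eq_comm, neg_eq_iff_eq_neg, ← smul_neg, ← h, ← hyw]

/-- The hypotheses of `closure_enclosedRegion_subset_enclosedRegion` from outward normals. -/
theorem closure_enclosedRegion_subset_of_normals {S' : Set (EuclideanSpace ℝ (Fin (n + 1)))}
    (hS' : IsClosed S') (h : S' ⊆ enclosedRegion (Set.range F))
    (hν : ∀ p, ∃ ν, IsOutwardUnitNormal F p ν) :
    closure (enclosedRegion S') ⊆ enclosedRegion (Set.range F) := by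
  -- This makes the `outside` condition, stated for the closure, exclude the surface itself as well.
  have hsub : Set.range F ⊆ closure (enclosedRegion (Set.range F)) := by
    rintro _ ⟨p, rfl⟩
    obtain ⟨ν, hν⟩ := hν p
    have ht : Filter.Tendsto (fun s : ℝ => F p - s • ν) (𝓝[>] 0) (𝓝 (F p)) := by
      have : ContinuousAt (fun s : ℝ => F p - s • ν) 0 := by fun_prop
      have h2 := this.tendsto
      simp only [zero_smul, sub_zero] at h2
      exact h2.mono_left nhdsWithin_le_nhds
    exact mem_closure_of_tendsto ht hν.inside
  refine closure_enclosedRegion_subset_enclosedRegion hS' h ?_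
  rintro _ ⟨p, rfl⟩
  obtain ⟨ν, hν⟩ := hν p
  refine ⟨ν, hν.outside.mono fun s hs hmem => hs ?_⟩
  exact hmem.elim (fun h => hsub h) fun h => subset_closure h

end Normal

/-! ### Traces of bilinear forms with respect to induced metrics. -/

section LinearAlgebra

/-- Writing `P` as a sum of rank-one matrices `v vᵀ` turns the trace into a sum of values `vᵀ G v`.
-/
theorem trace_mul_nonneg_of_posSemidef {n : ℕ} {G P : Matrix (Fin n) (Fin n) ℝ}
    (hG : G.PosSemidef) (hP : P.PosSemidef) : 0 ≤ (G * P).trace := by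
  obtain ⟨m, v, rfl⟩ := Matrix.posSemidef_iff_eq_sum_vecMulVec.1 hP
  rw [Finset.mul_sum, Matrix.trace_sum]
  refine Finset.sum_nonneg fun i _ => ?_
  rw [Matrix.mul_vecMulVec, Matrix.trace_vecMulVec, dotProduct_comm]
  exact hG.dotProduct_mulVec_nonneg (v i)

variable {n : ℕ} {W : Type*} [NormedAddCommGroup W] [InnerProductSpace ℝ W]

/-- Comparison of the traces of two bilinear forms with respect to the metrics induced by two
injective parametrizations `A`, `A'` of the same subspace. -/
theorem trace_inv_mul_le {A A' : EuclideanSpace ℝ (Fin n) →ₗ[ℝ] W} (hA : Function.Injective A)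
    (hA' : Function.Injective A') (hr : LinearMap.range A ≤ LinearMap.range A')
    {B B' : EuclideanSpace ℝ (Fin n) →ₗ[ℝ] EuclideanSpace ℝ (Fin n) →ₗ[ℝ] ℝ}
    (hB : ∀ u v, B u v = B v u) (hB' : ∀ u v, B' u v = B' v u)
    (h : ∀ u v, A u = A' v → B u u ≤ B' v v) :
    ((Matrix.of fun i j => inner ℝ (A (EuclideanSpace.single i 1))
        (A (EuclideanSpace.single j 1)) : Matrix (Fin n) (Fin n) ℝ)⁻¹ *
      Matrix.of fun i j => B (EuclideanSpace.single i 1) (EuclideanSpace.single j 1)).trace ≤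
    ((Matrix.of fun i j => inner ℝ (A' (EuclideanSpace.single i 1))
        (A' (EuclideanSpace.single j 1)) : Matrix (Fin n) (Fin n) ℝ)⁻¹ *
      Matrix.of fun i j => B' (EuclideanSpace.single i 1) (EuclideanSpace.single j 1)).trace := by
  classical
  set b := (EuclideanSpace.basisFun (Fin n) ℝ).toBasis with hb
  have hbi : ∀ i, b i = EuclideanSpace.single i 1 := by simp [hb]
  let Φ : (EuclideanSpace ℝ (Fin n) →ₗ[ℝ] EuclideanSpace ℝ (Fin n) →ₗ[ℝ] ℝ) ≃ₗ[ℝ]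
      Matrix (Fin n) (Fin n) ℝ := LinearMap.toMatrix₂ b b
  -- `L = A'⁻¹ ∘ A` is the change of parameters; pulling back by it puts both forms and both metrics
  -- on one space.
  let L : EuclideanSpace ℝ (Fin n) →ₗ[ℝ] EuclideanSpace ℝ (Fin n) :=
    (LinearEquiv.ofInjective A' hA').symm.toLinearMap ∘ₗ Submodule.inclusion hr ∘ₗ A.rangeRestrict
  have hL : ∀ u, A' (L u) = A u := by
    intro u
    have := congrArg Subtype.val ((LinearEquiv.ofInjective A' hA').apply_symm_apply
      (Submodule.inclusion hr (A.rangeRestrict u)))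
    exact this
  let G := (innerₗ W).compl₁₂ A A
  let G' := (innerₗ W).compl₁₂ A' A'
  have hG : G = G'.compl₁₂ L L := by
    ext u v
    simp [G, G', hL]
  have eG : (Matrix.of fun i j => inner ℝ (A (EuclideanSpace.single i 1))
      (A (EuclideanSpace.single j 1)) : Matrix (Fin n) (Fin n) ℝ) = Φ G := by
    ext i j; simp [Φ, G, LinearMap.toMatrix₂_apply, hbi]
  have eG' : (Matrix.of fun i j => inner ℝ (A' (EuclideanSpace.single i 1))
      (A' (EuclideanSpace.single j 1)) : Matrix (Fin n) (Fin n) ℝ) = Φ G' := by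
    ext i j; simp [Φ, G', LinearMap.toMatrix₂_apply, hbi]
  have eB : ∀ B : EuclideanSpace ℝ (Fin n) →ₗ[ℝ] EuclideanSpace ℝ (Fin n) →ₗ[ℝ] ℝ,
      (Matrix.of fun i j => B (EuclideanSpace.single i 1) (EuclideanSpace.single j 1) :
        Matrix (Fin n) (Fin n) ℝ) = Φ B := by
    intro B
    ext i j; simp [Φ, LinearMap.toMatrix₂_apply, hbi]
  have hpd : (Φ G).PosDef := by
    have : Φ G = Matrix.gram ℝ fun i => A (b i) := by
      ext i j; simp [Φ, G, LinearMap.toMatrix₂_apply, Matrix.gram_apply]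
    rw [this, Matrix.posDef_gram_iff_linearIndependent]
    exact b.linearIndependent.map' A (LinearMap.ker_eq_bot.2 hA)
  rw [eG, eG', eB B, eB B']
  set M := LinearMap.toMatrix b b L with hM
  have hc : ∀ C : EuclideanSpace ℝ (Fin n) →ₗ[ℝ] EuclideanSpace ℝ (Fin n) →ₗ[ℝ] ℝ,
      Φ (C.compl₁₂ L L) = M.transpose * Φ C * M := fun C =>
    LinearMap.toMatrix₂_compl₁₂ b b b b C L L
  have hMdet : IsUnit M.det := by
    have h1 := hpd.det_pos.ne'
    rw [hG, hc, Matrix.det_mul] at h1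
    exact (right_ne_zero_of_mul h1).isUnit
  have hMt : IsUnit M.transpose.det := by rwa [Matrix.det_transpose]
  -- The trace relative to a metric does not depend on the parametrization. What remains is the
  -- trace of `G⁻¹` times the positive semidefinite difference of the forms.
  have hconj : ((Φ G)⁻¹ * Φ (B'.compl₁₂ L L)).trace = ((Φ G')⁻¹ * Φ B').trace := by
    rw [hG, hc, hc, Matrix.mul_inv_rev, Matrix.mul_inv_rev, Matrix.mul_assoc, Matrix.trace_mul_comm]
    congr 1
    simp only [Matrix.mul_assoc]
    rw [Matrix.mul_nonsing_inv _ hMdet, Matrix.mul_one,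
      Matrix.nonsing_inv_mul_cancel_left _ _ hMt]
  rw [← hconj, ← sub_nonneg, ← Matrix.trace_sub, ← Matrix.mul_sub]
  refine trace_mul_nonneg_of_posSemidef hpd.inv.posSemidef ?_
  have hsub : Φ (B'.compl₁₂ L L) - Φ B = Φ (B'.compl₁₂ L L - B) := (map_sub Φ _ _).symm
  rw [hsub]
  refine .of_dotProduct_mulVec_nonneg ?_ fun x => ?_
  · ext i j
    simp [Φ, LinearMap.toMatrix₂_apply, hB (b i) (b j), hB' (L (b i)) (L (b j))]
  · have := dotProduct_toMatrix₂_mulVec b b (B'.compl₁₂ L L - B) x x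
    have h2 := h (b.equivFun.symm x) (L (b.equivFun.symm x)) (hL _).symm
    rw [star_trivial]
    refine le_of_le_of_eq ?_ this.symm
    exact sub_nonneg.2 h2

end LinearAlgebra

/-! ### Second-order conditions at a minimum. -/

section SecondOrder

/-- The second derivative is nonnegative at a local minimum. -/
theorem second_deriv_nonneg_of_isLocalMin {f f' : ℝ → ℝ} {c x : ℝ} (hmin : IsLocalMin f x)
    (hf : ∀ᶠ s in 𝓝 x, HasDerivAt f (f' s) s) (hf' : HasDerivAt f' c x) : 0 ≤ c := by
  by_contra! hc
  have hd : deriv f =ᶠ[𝓝 x] f' := hf.mono fun s hs => hs.deriv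
  have hdd : deriv (deriv f) x = c := by rw [hd.deriv_eq, hf'.deriv]
  have hfx : HasDerivAt f (f' x) x := hf.self_of_nhds
  have hmax : IsLocalMax f x :=
    -- If `c < 0`, the point is also a local maximum, so `f` is locally constant and `c = 0`.
    isLocalMax_of_deriv_deriv_neg (by rwa [hdd]) hmin.deriv_eq_zero hfx.continuousAt
  have hconst : f =ᶠ[𝓝 x] fun _ => f x := by
    filter_upwards [hmin, hmax] with s h1 h2 using le_antisymm h2 h1
  have : deriv (deriv f) x = 0 := by
    rw [hconst.deriv.deriv_eq]; simp
  linarith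

variable {V V' W : Type*} [NormedAddCommGroup V] [NormedSpace ℝ V] [NormedAddCommGroup V']
  [NormedSpace ℝ V'] [NormedAddCommGroup W] [InnerProductSpace ℝ W]

theorem eventually_hasDerivAt_comp_line {φ : V → W} {a : V} (hφ : ContDiffAt ℝ 2 φ a) (u : V) :
    (∀ᶠ s : ℝ in 𝓝 0, HasDerivAt (fun s : ℝ => φ (a + s • u)) (fderiv ℝ φ (a + s • u) u) s) ∧
      HasDerivAt (fun s : ℝ => fderiv ℝ φ (a + s • u) u) (fderiv ℝ (fderiv ℝ φ) a u u) 0 := by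
  have hline : ∀ s : ℝ, HasDerivAt (fun s : ℝ => a + s • u) u s := by
    intro s
    simpa using ((hasDerivAt_id s).smul_const u).const_add a
  have hcont : Filter.Tendsto (fun s : ℝ => a + s • u) (𝓝 0) (𝓝 a) := by
    have := (hline 0).continuousAt.tendsto
    simpa using this
  constructor
  · have h1 : ∀ᶠ z in 𝓝 a, DifferentiableAt ℝ φ z :=
      (hφ.eventually (by simp)).mono fun z hz => hz.differentiableAt two_ne_zero
    filter_upwards [hcont.eventually h1] with s hs
    exact hs.hasFDerivAt.comp_hasDerivAt s (hline s)
  · have h2 : DifferentiableAt ℝ (fderiv ℝ φ) a :=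
      (hφ.fderiv_right (m := 1) (by norm_num)).differentiableAt one_ne_zero
    have h3 : HasFDerivAt (fderiv ℝ φ) (fderiv ℝ (fderiv ℝ φ) a) (a + (0 : ℝ) • u) := by
      simpa using h2.hasFDerivAt
    have h4 := h3.comp_hasDerivAt (0 : ℝ) (hline 0)
    simpa using h4.clm_apply (hasDerivAt_const (0 : ℝ) u)

/-- Second order condition at a pair of points realizing the distance between two parametrized
submanifolds, in directions with equal velocities. -/
theorem inner_fderiv_fderiv_le_of_isMin {φ : V → W} {ψ : V' → W} {a : V} {b : V'}
    (hφ : ContDiffAt ℝ 2 φ a) (hψ : ContDiffAt ℝ 2 ψ b)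
    (hmin : ∀ x y, ‖φ a - ψ b‖ ≤ ‖φ x - ψ y‖) {u : V} {v : V'}
    (huv : fderiv ℝ φ a u = fderiv ℝ ψ b v) :
    inner ℝ (φ a - ψ b) (fderiv ℝ (fderiv ℝ ψ) b v v) ≤
      inner ℝ (φ a - ψ b) (fderiv ℝ (fderiv ℝ φ) a u u) := by
  obtain ⟨h1, h2⟩ := eventually_hasDerivAt_comp_line hφ u
  obtain ⟨h3, h4⟩ := eventually_hasDerivAt_comp_line hψ v
  set f : ℝ → W := fun s => φ (a + s • u) - ψ (b + s • v) with hf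
  set f' : ℝ → W := fun s => fderiv ℝ φ (a + s • u) u - fderiv ℝ ψ (b + s • v) v with hf'
  have hd : ∀ᶠ s in 𝓝 (0 : ℝ), HasDerivAt f (f' s) s := by
    filter_upwards [h1, h3] with s hs1 hs3 using hs1.sub hs3
  have hd' : HasDerivAt f' (fderiv ℝ (fderiv ℝ φ) a u u - fderiv ℝ (fderiv ℝ ψ) b v v) 0 :=
    h2.sub h4
  have hf0 : f 0 = φ a - ψ b := by simp [hf]
  -- Equal velocities remove the term `2|f'|²` from the second derivative of `|f|²`, leaving only
  -- `2⟨f, f''⟩`.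
  have hf'0 : f' 0 = 0 := by simp [hf', huv]
  have hm : IsLocalMin (fun s => ‖f s‖ ^ 2) 0 := by
    refine Filter.Eventually.of_forall fun s => ?_
    simp only [hf0]
    gcongr
    exact hmin _ _
  have := second_deriv_nonneg_of_isLocalMin hm (f' := fun s => 2 * inner ℝ (f s) (f' s))
    (hd.mono fun s hs => hs.norm_sq) ((hd.self_of_nhds.inner ℝ hd').const_mul 2)
  rw [hf0, hf'0, inner_zero_left, add_zero, inner_sub_right] at this
  linarith

end SecondOrder

/-! ### Comparison of mean curvatures at a closest pair. -/

section Comparison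

variable {n : ℕ} {N : Type*} [TopologicalSpace N] [ChartedSpace (EuclideanSpace ℝ (Fin n)) N]
  {N' : Type*} [TopologicalSpace N'] [ChartedSpace (EuclideanSpace ℝ (Fin n)) N']
  {F : N → EuclideanSpace ℝ (Fin (n + 1))} {F' : N' → EuclideanSpace ℝ (Fin (n + 1))}
  {p : N} {q : N'}

theorem localParam_apply (F : N → EuclideanSpace ℝ (Fin (n + 1))) (p : N) :
    localParam F p (extChartAt (𝓡 n) p p) = F p := by
  simp [localParam]

theorem contDiffAt_localParam [IsManifold (𝓡 n) ∞ N]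
    (hF : ContMDiff (𝓡 n) 𝓘(ℝ, EuclideanSpace ℝ (Fin (n + 1))) ∞ F) (p : N) :
    ContDiffAt ℝ ∞ (localParam F p) (extChartAt (𝓡 n) p p) := by
  rw [← contMDiffAt_iff_contDiffAt]
  refine ContMDiffAt.comp _ (hF _) ?_
  exact (contMDiffOn_extChartAt_symm p).contMDiffAt (extChartAt_target_mem_nhds p)

/-- The tangent space at a nearest point to `y` is orthogonal to the direction to `y`. -/
theorem inner_mfderiv_eq_zero_of_isMin
    (hF : MDifferentiableAt (𝓡 n) 𝓘(ℝ, EuclideanSpace ℝ (Fin (n + 1))) F p)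
    (hd : DifferentiableAt ℝ (localParam F p) (extChartAt (𝓡 n) p p))
    {y : EuclideanSpace ℝ (Fin (n + 1))} (hmin : ∀ p', ‖F p - y‖ ≤ ‖F p' - y‖)
    (v : TangentSpace (𝓡 n) p) :
    inner (E := EuclideanSpace ℝ (Fin (n + 1))) ℝ
      (mfderiv (𝓡 n) 𝓘(ℝ, EuclideanSpace ℝ (Fin (n + 1))) F p v) (F p - y) = 0 := by
  rw [mfderiv_eq_fderiv_localParam hF]
  set a := extChartAt (𝓡 n) p p with ha
  change EuclideanSpace ℝ (Fin n) at v
  have hline : HasDerivAt (fun s : ℝ => a + s • v) v 0 := by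
    simpa using ((hasDerivAt_id (0 : ℝ)).smul_const v).const_add a
  have h3 : HasFDerivAt (localParam F p) (fderiv ℝ (localParam F p) a) (a + (0 : ℝ) • v) := by
    simpa using hd.hasFDerivAt
  have h4 := ((h3.comp_hasDerivAt (0 : ℝ) hline).sub_const y).norm_sq
  have hm : IsLocalMin (fun s : ℝ => ‖localParam F p (a + s • v) - y‖ ^ 2) 0 := by
    refine Filter.Eventually.of_forall fun s => ?_
    simp only [zero_smul, add_zero, ha, localParam_apply]
    gcongr
    exact hmin _
  have h5 := hm.hasDerivAt_eq_zero h4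
  simp only [Function.comp_apply, zero_smul, add_zero, ha, localParam_apply] at h5
  exact (real_inner_comm _ _).trans ((mul_eq_zero.1 h5).resolve_left two_ne_zero)

/-- The form `(u, v) ↦ -⟨D²φ(u, v), ν⟩`. -/
def negInnerSndDeriv (φ : EuclideanSpace ℝ (Fin n) → EuclideanSpace ℝ (Fin (n + 1)))
    (a : EuclideanSpace ℝ (Fin n)) (ν : EuclideanSpace ℝ (Fin (n + 1))) :
    EuclideanSpace ℝ (Fin n) →ₗ[ℝ] EuclideanSpace ℝ (Fin n) →ₗ[ℝ] ℝ :=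
  LinearMap.mk₂ ℝ (fun u v => -inner ℝ (fderiv ℝ (fderiv ℝ φ) a u v) ν)
    (by intros; simp [inner_add_left]; ring) (by intros; simp [inner_smul_left])
    (by intros; simp [inner_add_left]; ring) (by intros; simp [inner_smul_left])

/-- At a pair of points realizing the distance between two hypersurfaces, the hypersurface on the
side towards which the common normal points has the smaller mean curvature. -/
theorem meanCurvature_le_of_isMin [IsManifold (𝓡 n) ∞ N] [IsManifold (𝓡 n) ∞ N']
    (hF : ContMDiff (𝓡 n) 𝓘(ℝ, EuclideanSpace ℝ (Fin (n + 1))) ∞ F)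
    (hF' : ContMDiff (𝓡 n) 𝓘(ℝ, EuclideanSpace ℝ (Fin (n + 1))) ∞ F')
    (hi : Function.Injective (mfderiv (𝓡 n) 𝓘(ℝ, EuclideanSpace ℝ (Fin (n + 1))) F p))
    (hi' : Function.Injective (mfderiv (𝓡 n) 𝓘(ℝ, EuclideanSpace ℝ (Fin (n + 1))) F' q))
    (hmin : ∀ p' q', ‖F p - F' q‖ ≤ ‖F p' - F' q'‖) (hne : F p ≠ F' q)
    {ν : EuclideanSpace ℝ (Fin (n + 1))} (hν : ‖F p - F' q‖ • ν = F p - F' q) :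
    meanCurvature F p ν ≤ meanCurvature F' q ν := by
  have hpos : 0 < ‖F p - F' q‖ := norm_pos_iff.2 (sub_ne_zero.2 hne)
  have hinf : (∞ : WithTop ℕ∞) ≠ 0 := by simp
  have htwo : (2 : WithTop ℕ∞) ≤ ∞ :=
    WithTop.coe_le_coe.2 (le_top : (2 : ℕ∞) ≤ ⊤)
  have hm := (hF.mdifferentiable hinf) p
  have hm' := (hF'.mdifferentiable hinf) q
  have hc := contDiffAt_localParam hF p
  have hc' := contDiffAt_localParam hF' q
  have ho := inner_mfderiv_eq_zero_of_isMin hm (hc.differentiableAt hinf) (y := F' q)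
    fun p' => hmin p' q
  have ho' := inner_mfderiv_eq_zero_of_isMin hm' (hc'.differentiableAt hinf) (y := F p)
    fun q' => by rw [norm_sub_rev, norm_sub_rev (F' q')]; exact hmin p q'
  rw [mfderiv_eq_fderiv_localParam hm] at hi ho
  rw [mfderiv_eq_fderiv_localParam hm'] at hi' ho'
  set a := extChartAt (𝓡 n) p p with ha
  set b := extChartAt (𝓡 n) q q with hb
  set A : EuclideanSpace ℝ (Fin n) →L[ℝ] EuclideanSpace ℝ (Fin (n + 1)) :=
    fderiv ℝ (localParam F p) a with hA
  set A' : EuclideanSpace ℝ (Fin n) →L[ℝ] EuclideanSpace ℝ (Fin (n + 1)) :=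
    fderiv ℝ (localParam F' q) b with hA'
  -- Both tangent spaces lie in the `n`-dimensional hyperplane orthogonal to `F p - F' q`, and by
  -- dimension that of `F'` fills it.
  have hrange : LinearMap.range A.toLinearMap ≤ LinearMap.range A'.toLinearMap := by
    have hK : Module.finrank ℝ (ℝ ∙ (F p - F' q))ᗮ = n :=
      haveI : Fact (Module.finrank ℝ (EuclideanSpace ℝ (Fin (n + 1))) = n + 1) :=
        ⟨finrank_euclideanSpace_fin⟩
      Submodule.finrank_orthogonal_span_singleton (sub_ne_zero.2 hne)
    have e1 : LinearMap.range A.toLinearMap ≤ (ℝ ∙ (F p - F' q))ᗮ := by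
      rintro _ ⟨u, rfl⟩
      rw [Submodule.mem_orthogonal_singleton_iff_inner_left]
      exact ho u
    have e2 : LinearMap.range A'.toLinearMap ≤ (ℝ ∙ (F p - F' q))ᗮ := by
      rintro _ ⟨u, rfl⟩
      rw [Submodule.mem_orthogonal_singleton_iff_inner_left, ← neg_sub (F' q), inner_neg_right,
        neg_eq_zero]
      exact ho' u
    have e3 : LinearMap.range A'.toLinearMap = (ℝ ∙ (F p - F' q))ᗮ := by
      refine Submodule.eq_of_le_of_finrank_eq e2 ?_
      have hfr := LinearMap.finrank_range_of_inj (f := A'.toLinearMap) hi'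
      rw [finrank_euclideanSpace_fin] at hfr
      rw [hK]
      exact hfr
    rw [e3]
    exact e1
  have hsymm : ∀ {φ : EuclideanSpace ℝ (Fin n) → EuclideanSpace ℝ (Fin (n + 1))} {a},
      ContDiffAt ℝ ∞ φ a → ∀ u v, negInnerSndDeriv φ a ν u v = negInnerSndDeriv φ a ν v u := by
    intro φ a hφ u v
    have := hφ.isSymmSndFDerivAt (by simpa using htwo) u v
    simp [negInnerSndDeriv, this]
  refine trace_inv_mul_le (A := A.toLinearMap) (A' := A'.toLinearMap) hi hi' hrange
    (B := negInnerSndDeriv (localParam F p) a ν) (B' := negInnerSndDeriv (localParam F' q) b ν)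
    (hsymm hc) (hsymm hc') fun u v huv => ?_
  have hh := inner_fderiv_fderiv_le_of_isMin (hc.of_le htwo) (hc'.of_le htwo)
    (fun x y => by rw [localParam_apply, localParam_apply]; exact hmin _ _) huv
  rw [localParam_apply, localParam_apply, ← hν, inner_smul_left, inner_smul_left] at hh
  have hh' := le_of_mul_le_mul_left hh hpos
  simp only [negInnerSndDeriv, LinearMap.mk₂_apply]
  rw [real_inner_comm, real_inner_comm ν]
  linarith

end Comparison

/-! ### The time interval. -/

section Time

variable {T : EReal}

theorem ordConnected_timeInterval : (timeInterval T).OrdConnected :=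
  ⟨fun _ hx _ hy _ hz =>
    ⟨hx.1.trans hz.1, lt_of_le_of_lt (EReal.coe_le_coe_iff.2 hz.2) hy.2⟩⟩

theorem zero_mem_timeInterval {t : ℝ} (ht : t ∈ timeInterval T) : (0 : ℝ) ∈ timeInterval T :=
  ⟨le_rfl, lt_of_le_of_lt (EReal.coe_le_coe_iff.2 ht.1) ht.2⟩

/-- A nonempty `[0, T)` is convex with nonempty interior. Uniqueness identifies `derivWithin` with
the flow velocity, also at the endpoint `0`. -/
theorem uniqueDiffOn_timeInterval : UniqueDiffOn ℝ (timeInterval T) := by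
  intro t ht
  obtain ⟨r, hr, hrT⟩ := EReal.lt_iff_exists_real_btwn.1 ht.2
  have htr : t < r := EReal.coe_lt_coe_iff.1 hr
  have hsub : Set.Ioo t r ⊆ interior (timeInterval T) :=
    interior_maximal (fun s hs => ⟨ht.1.trans hs.1.le,
      lt_trans (EReal.coe_lt_coe_iff.2 hs.2) hrT⟩) isOpen_Ioo
  exact uniqueDiffOn_convex ordConnected_timeInterval.convex
    ((Set.nonempty_Ioo.2 htr).mono hsub) t ht

end Time

/-! ### Joint continuity of the velocity and smoothness of time slices. -/

section Velocity

variable {n : ℕ} {N : Type*} [TopologicalSpace N] [ChartedSpace (EuclideanSpace ℝ (Fin n)) N]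
  {W : Type*} [NormedAddCommGroup W] [NormedSpace ℝ W]
  {F : ℝ → N → W} {J : Set ℝ}

/-- The velocity of a smooth family is continuous in space and time. -/
theorem continuousOn_derivWithin_of_contMDiffOn [IsManifold (𝓡 n) ∞ N]
    (hF : ContMDiffOn ((𝓡 n).prod 𝓘(ℝ, ℝ)) 𝓘(ℝ, W) ∞ (fun x : N × ℝ => F x.2 x.1)
      (Set.univ ×ˢ J)) (hJ : UniqueDiffOn ℝ J) :
    ContinuousOn (fun x : N × ℝ => derivWithin (fun s => F s x.1) J x.2) (Set.univ ×ˢ J) := by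
  rintro ⟨p₀, t₀⟩ ⟨-, ht₀⟩
  set e := extChartAt (𝓡 n) p₀ with he
  set G : EuclideanSpace ℝ (Fin n) × ℝ → W := fun z => F z.2 (e.symm z.1) with hG
  have hGs : ContDiffOn ℝ ∞ G (e.target ×ˢ J) := by
    rw [← contMDiffOn_iff_contDiffOn, modelWithCornersSelf_prod, ← chartedSpaceSelf_prod]
    have h1 : ContMDiffOn (𝓘(ℝ, EuclideanSpace ℝ (Fin n)).prod 𝓘(ℝ, ℝ))
        ((𝓡 n).prod 𝓘(ℝ, ℝ)) ∞
        (fun z : EuclideanSpace ℝ (Fin n) × ℝ => ((e.symm z.1, z.2) : N × ℝ))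
        (e.target ×ˢ J) := by
      refine ContMDiffOn.prodMk ?_ contMDiffOn_snd
      exact (contMDiffOn_extChartAt_symm p₀).comp contMDiffOn_fst fun z hz => hz.1
    exact hF.comp h1 fun z hz => ⟨trivial, hz.2⟩
  have hU : UniqueDiffOn ℝ (e.target ×ˢ J) := (isOpen_extChartAt_target p₀).uniqueDiffOn.prod hJ
  have hcont := hGs.continuousOn_fderivWithin hU (by simp)
  -- In a chart the velocity is the total derivative in the pure time direction `(0, 1)`, and that
  -- derivative is continuous.
  have heq : ∀ p ∈ e.source, ∀ t ∈ J, derivWithin (fun s => F s p) J t =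
      fderivWithin ℝ G (e.target ×ˢ J) (e p, t) (0, 1) := by
    intro p hp t ht
    have hmem : (e p, t) ∈ e.target ×ˢ J := ⟨e.map_source hp, ht⟩
    have h1 : HasFDerivWithinAt G (fderivWithin ℝ G (e.target ×ˢ J) (e p, t))
        (e.target ×ˢ J) (e p, t) :=
      ((hGs.differentiableOn (by simp)) _ hmem).hasFDerivWithinAt
    have h2 : HasDerivWithinAt (fun s : ℝ => (e p, s)) (0, 1) J t :=
      (hasDerivWithinAt_const t J (e p)).prodMk (hasDerivWithinAt_id t J)
    have h3 := h1.comp_hasDerivWithinAt t h2 fun s hs => ⟨e.map_source hp, hs⟩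
    have h4 : (G ∘ fun s : ℝ => (e p, s)) = fun s => F s p := by
      funext s
      simp [hG, e.left_inv hp]
    rw [h4] at h3
    exact h3.derivWithin (hJ t ht)
  have hsrc : e.source ×ˢ (Set.univ : Set ℝ) ∈ 𝓝 (p₀, t₀) :=
    prod_mem_nhds (extChartAt_source_mem_nhds p₀) Filter.univ_mem
  have hmaps : ContinuousWithinAt (fun x : N × ℝ => (e x.1, x.2))
      ((Set.univ ×ˢ J) ∩ e.source ×ˢ (Set.univ : Set ℝ)) (p₀, t₀) := by
    refine ContinuousAt.continuousWithinAt ?_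
    have h1 : ContinuousAt (fun x : N × ℝ => e x.1) (p₀, t₀) :=
      ContinuousAt.comp (x := (p₀, t₀)) (g := e) (continuousAt_extChartAt p₀) continuousAt_fst
    exact h1.prodMk continuousAt_snd
  rw [← continuousWithinAt_inter hsrc]
  have hc : ContinuousWithinAt (fun z => fderivWithin ℝ G (e.target ×ˢ J) z (0, 1))
      (e.target ×ˢ J) (e p₀, t₀) :=
    (hcont _ ⟨mem_extChartAt_target p₀, ht₀⟩).clm_apply continuousWithinAt_const
  have hcomp := ContinuousWithinAt.comp (x := (p₀, t₀)) (t := e.target ×ˢ J) hc hmaps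
    (fun x hx => ⟨e.map_source hx.2.1, hx.1.2⟩)
  exact hcomp.congr (fun x hx => heq x.1 hx.2.1 x.2 hx.1.2)
    (heq p₀ (mem_extChartAt_source p₀) t₀ ht₀)

theorem contMDiff_of_contMDiffOn_prod
    (hF : ContMDiffOn ((𝓡 n).prod 𝓘(ℝ, ℝ)) 𝓘(ℝ, W) ∞ (fun x : N × ℝ => F x.2 x.1)
      (Set.univ ×ˢ J)) {t : ℝ} (ht : t ∈ J) : ContMDiff (𝓡 n) 𝓘(ℝ, W) ∞ (F t) := by
  rw [← contMDiffOn_univ]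
  have h1 : ContMDiffOn (𝓡 n) ((𝓡 n).prod 𝓘(ℝ, ℝ)) ∞ (fun p : N => (p, t)) Set.univ :=
    (contMDiff_id.prodMk contMDiff_const).contMDiffOn
  exact hF.comp h1 fun p _ => ⟨trivial, ht⟩

end Velocity

/-! ### Attainment and continuity of the distance between compact families. -/

section SetDist

variable {m : ℕ} {X Y : Type*}

theorem setDist_range_le {f : X → EuclideanSpace ℝ (Fin m)} {g : Y → EuclideanSpace ℝ (Fin m)}
    (x : X) (y : Y) : setDist (Set.range f) (Set.range g) ≤ ‖f x - g y‖ := by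
  rw [← dist_eq_norm]
  refine csInf_le ⟨0, ?_⟩ ⟨f x, ⟨x, rfl⟩, g y, ⟨y, rfl⟩, rfl⟩
  rintro _ ⟨a, -, b, -, rfl⟩
  exact dist_nonneg

theorem setDist_range_eq (f : X → EuclideanSpace ℝ (Fin m)) (g : Y → EuclideanSpace ℝ (Fin m)) :
    setDist (Set.range f) (Set.range g) =
      sInf ((fun x : X × Y => ‖f x.1 - g x.2‖) '' Set.univ) := by
  rw [setDist]
  congr 1
  ext r
  simp [dist_eq_norm, Set.mem_image2]

variable [TopologicalSpace X] [TopologicalSpace Y]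

theorem exists_norm_sub_eq_setDist [CompactSpace X] [CompactSpace Y] [Nonempty X] [Nonempty Y]
    {f : X → EuclideanSpace ℝ (Fin m)} {g : Y → EuclideanSpace ℝ (Fin m)} (hf : Continuous f)
    (hg : Continuous g) : ∃ x y, ‖f x - g y‖ = setDist (Set.range f) (Set.range g) := by
  rw [setDist_range_eq]
  have hc : Continuous fun x : X × Y => ‖f x.1 - g x.2‖ := by fun_prop
  obtain ⟨x, -, hx⟩ := (isCompact_univ (X := X × Y)).exists_sInf_image_eq Set.univ_nonempty
    hc.continuousOn
  exact ⟨x.1, x.2, hx.symm⟩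

theorem continuousOn_setDist_range [CompactSpace X] [CompactSpace Y]
    {f : ℝ → X → EuclideanSpace ℝ (Fin m)} {g : ℝ → Y → EuclideanSpace ℝ (Fin m)} {J : Set ℝ}
    (hf : ContinuousOn (fun x : X × ℝ => f x.2 x.1) (Set.univ ×ˢ J))
    (hg : ContinuousOn (fun x : Y × ℝ => g x.2 x.1) (Set.univ ×ˢ J)) :
    ContinuousOn (fun t => setDist (Set.range (f t)) (Set.range (g t))) J := by
  rw [continuousOn_iff_continuous_domRestrict]
  simp only [Set.domRestrict_def, setDist_range_eq]
  refine isCompact_univ.continuous_sInf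
    (f := fun (t : J) (x : X × Y) => ‖f t x.1 - g t x.2‖) ?_
  have h1 : Continuous fun z : J × (X × Y) => f z.1 z.2.1 :=
    hf.comp_continuous (f := fun z : J × (X × Y) => (z.2.1, (z.1 : ℝ))) (by fun_prop)
      fun z => ⟨trivial, z.1.2⟩
  have h2 : Continuous fun z : J × (X × Y) => g z.1 z.2.2 :=
    hg.comp_continuous (f := fun z : J × (X × Y) => (z.2.2, (z.1 : ℝ))) (by fun_prop)
      fun z => ⟨trivial, z.1.2⟩
  exact (h1.sub h2).norm

/-- Projection along a compact factor is a closed map. With `f = 0` expressing minimality of a pair,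
this passes a sign condition on closest pairs to limits of times. -/
theorem isClosed_setOf_exists_eq_zero_and_nonneg [CompactSpace X] {K : Set ℝ} (hK : IsCompact K)
    {f g : X × ℝ → ℝ} (hf : ContinuousOn f (Set.univ ×ˢ K))
    (hg : ContinuousOn g (Set.univ ×ˢ K)) :
    IsClosed {t | t ∈ K ∧ ∃ x, f (x, t) = 0 ∧ 0 ≤ g (x, t)} := by
  have hcl : IsClosed ((Set.univ : Set X) ×ˢ K) := isClosed_univ.prod hK.isClosed
  have h1 := hf.preimage_isClosed_of_isClosed hcl (isClosed_singleton (x := (0 : ℝ)))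
  have h2 := hg.preimage_isClosed_of_isClosed hcl (isClosed_Ici (a := (0 : ℝ)))
  have h3 : IsClosed (Prod.snd '' (((Set.univ : Set X) ×ˢ K ∩ f ⁻¹' {0}) ∩
      ((Set.univ : Set X) ×ˢ K ∩ g ⁻¹' Set.Ici 0))) :=
    isClosedMap_snd_of_compactSpace _ (h1.inter h2)
  convert h3 using 1
  ext t
  constructor
  · rintro ⟨ht, x, hx1, hx2⟩
    exact ⟨(x, t), ⟨⟨⟨trivial, ht⟩, hx1⟩, ⟨trivial, ht⟩, hx2⟩, rfl⟩
  · rintro ⟨⟨x, t⟩, ⟨⟨⟨-, ht⟩, hx1⟩, -, hx2⟩, rfl⟩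
    exact ⟨ht, x, hx1, hx2⟩

end SetDist

/-! ### Monotonicity of the distance and preservation of nesting. -/

section Flow

variable {n : ℕ}
  {N : Type*} [TopologicalSpace N] [ChartedSpace (EuclideanSpace ℝ (Fin n)) N]
  {N' : Type*} [TopologicalSpace N'] [ChartedSpace (EuclideanSpace ℝ (Fin n)) N']
  {T T' : EReal} {F : ℝ → N → EuclideanSpace ℝ (Fin (n + 1))}
  {F' : ℝ → N' → EuclideanSpace ℝ (Fin (n + 1))} {t : ℝ}

/-- The point at parameter `s` has distance `(1 - s)|f x - y|` from `y`, closer than the nearest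
point of the range. -/
theorem add_smul_sub_notMem_range_of_isMin {X : Type*} {m : ℕ}
    {f : X → EuclideanSpace ℝ (Fin m)} {x : X} {y : EuclideanSpace ℝ (Fin m)} (hne : f x ≠ y)
    (hmin : ∀ x', ‖f x - y‖ ≤ ‖f x' - y‖) {s : ℝ} (hs : s ∈ Set.Ioc (0 : ℝ) 1) :
    f x + s • (y - f x) ∉ Set.range f := by
  rintro ⟨x', hx'⟩
  have hpos : 0 < ‖f x - y‖ := norm_pos_iff.2 (sub_ne_zero.2 hne)
  have h1 : f x' - y = (1 - s) • (f x - y) := by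
    rw [hx']; module
  have h2 := hmin x'
  rw [h1, norm_smul, Real.norm_of_nonneg (by linarith [hs.2])] at h2
  nlinarith [hs.1]

theorem IsEmbeddedSolution.closure_enclosedRegion_subset [CompactSpace N']
    (hF : IsEmbeddedSolution F T) (hF' : IsEmbeddedSolution F' T') (ht : t ∈ timeInterval T)
    (ht' : t ∈ timeInterval T')
    (h : Set.range (F' t) ⊆ enclosedRegion (Set.range (F t))) :
    closure (enclosedRegion (Set.range (F' t))) ⊆ enclosedRegion (Set.range (F t)) := by
  refine closure_enclosedRegion_subset_of_normals
    (isCompact_range (hF'.embedding t ht').continuous).isClosed h fun p => ?_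
  obtain ⟨ν, hν, -⟩ := hF.flow t ht p
  exact ⟨ν, hν⟩

/-- A pair of points realizing the distance between the two solutions at time `t`. -/
theorem exists_pair_of_isEmbeddedSolution [CompactSpace N] [CompactSpace N']
    [Nonempty N] [Nonempty N'] (hF : IsEmbeddedSolution F T)
    (hF' : IsEmbeddedSolution F' T') (ht : t ∈ timeInterval T) (ht' : t ∈ timeInterval T') :
    ∃ p q, ‖F t p - F' t q‖ = setDist (Set.range (F t)) (Set.range (F' t)) ∧
      ∀ p' q', ‖F t p - F' t q‖ ≤ ‖F t p' - F' t q'‖ := by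
  obtain ⟨p, q, h⟩ := exists_norm_sub_eq_setDist (hF.embedding t ht).continuous
    (hF'.embedding t ht').continuous
  exact ⟨p, q, h, fun p' q' => h ▸ setDist_range_le p' q'⟩

theorem IsEmbeddedSolution.continuousOn_setDist [CompactSpace N] [CompactSpace N']
    (hF : IsEmbeddedSolution F T) (hF' : IsEmbeddedSolution F' T') :
    ContinuousOn (fun t => setDist (Set.range (F t)) (Set.range (F' t)))
      (timeInterval T ∩ timeInterval T') :=
  continuousOn_setDist_range
    (hF.smooth.continuousOn.mono (Set.prod_mono_right Set.inter_subset_left))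
    (hF'.smooth.continuousOn.mono (Set.prod_mono_right Set.inter_subset_right))

/-- Nestedness is detected at any pair of points realizing the distance. -/
theorem range_subset_enclosedRegion_of_mem [ConnectedSpace N'] {X : Type*}
    {f : X → EuclideanSpace ℝ (Fin (n + 1))}
    (hF' : IsEmbeddedSolution F' T') (ht' : t ∈ timeInterval T') {p : X} {q : N'}
    (hne : f p ≠ F' t q) (hmin : ∀ p' q', ‖f p - F' t q‖ ≤ ‖f p' - F' t q'‖)
    (h : F' t q ∈ enclosedRegion (Set.range f)) :
    Set.range (F' t) ⊆ enclosedRegion (Set.range f) := by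
  have hpre : IsPreconnected (Set.range (F' t)) :=
    isPreconnected_range (hF'.embedding t ht').continuous
  rintro _ ⟨q', rfl⟩
  refine (mem_enclosedRegion_iff_of_isPreconnected hpre ?_ ⟨q, rfl⟩ ⟨q', rfl⟩).1 h
  rintro _ ⟨q₁, rfl⟩ ⟨p₁, hp₁⟩
  have := hmin p₁ q₁
  rw [hp₁, sub_self, norm_zero] at this
  exact hne (sub_eq_zero.1 (norm_le_zero_iff.1 this))

variable [IsManifold (𝓡 n) ∞ N'] [IsManifold (𝓡 n) ∞ N]

/-- The flow data at a point of the hypersurface nearest to `y`. -/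
theorem IsEmbeddedSolution.exists_normal_of_isMin (hF : IsEmbeddedSolution F T)
    (ht : t ∈ timeInterval T) {p : N} {y : EuclideanSpace ℝ (Fin (n + 1))} (hne : F t p ≠ y)
    (hmin : ∀ p', ‖F t p - y‖ ≤ ‖F t p' - y‖) :
    ∃ ν : EuclideanSpace ℝ (Fin (n + 1)), ‖ν‖ = 1 ∧ 0 < meanCurvature (F t) p ν ∧
      HasDerivWithinAt (fun s => F s p) ((meanCurvature (F t) p ν)⁻¹ • ν) (timeInterval T) t ∧
      (y ∈ enclosedRegion (Set.range (F t)) → ‖F t p - y‖ • ν = F t p - y) ∧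
      (y ∉ enclosedRegion (Set.range (F t)) → ‖F t p - y‖ • ν = -(F t p - y)) := by
  obtain ⟨ν, hν, hH, hd⟩ := hF.flow t ht p
  have hs := contMDiff_of_contMDiffOn_prod hF.smooth ht
  have hinf : (∞ : WithTop ℕ∞) ≠ 0 := by simp
  have horth := inner_mfderiv_eq_zero_of_isMin ((hs.mdifferentiable hinf) p)
    ((contDiffAt_localParam hs p).differentiableAt hinf) hmin
  exact ⟨ν, hν.norm_eq_one, hH, hd, hν.norm_smul_eq (hF.immersion t ht p) hne
    (fun s hs => add_smul_sub_notMem_range_of_isMin hne hmin hs) horth⟩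

/-- Whether `y` is enclosed is detected by the sign of the velocity at a nearest point. -/
theorem IsEmbeddedSolution.inner_velocity_of_isMin (hF : IsEmbeddedSolution F T)
    (ht : t ∈ timeInterval T) {p : N} {y : EuclideanSpace ℝ (Fin (n + 1))} (hne : F t p ≠ y)
    (hmin : ∀ p', ‖F t p - y‖ ≤ ‖F t p' - y‖) :
    (y ∈ enclosedRegion (Set.range (F t)) →
      0 < inner ℝ (derivWithin (fun s => F s p) (timeInterval T) t) (F t p - y)) ∧
    (y ∉ enclosedRegion (Set.range (F t)) →
      inner ℝ (derivWithin (fun s => F s p) (timeInterval T) t) (F t p - y) < 0) := by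
  obtain ⟨ν, hν, hH, hd, h1, h2⟩ := hF.exists_normal_of_isMin ht hne hmin
  have hpos : 0 < ‖F t p - y‖ := norm_pos_iff.2 (sub_ne_zero.2 hne)
  have hνν : inner ℝ ν ν = (1 : ℝ) := by rw [real_inner_self_eq_norm_sq, hν, one_pow]
  have hmul := mul_pos (inv_pos.2 hH) hpos
  rw [hd.derivWithin (uniqueDiffOn_timeInterval t ht), inner_smul_left]
  simp only [conj_trivial]
  constructor
  · intro hy
    rw [← h1 hy, inner_smul_right, hνν]
    simpa using hmul
  · intro hy
    rw [← neg_neg (F t p - y), ← h2 hy, inner_neg_right, inner_smul_right, hνν]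
    simpa using hmul

/-- The squared distance between the trajectories of a pair of points realizing the distance
between nested solutions has nonnegative derivative. -/
theorem exists_hasDerivWithinAt_norm_sub_sq [CompactSpace N']
    (hF : IsEmbeddedSolution F T) (hF' : IsEmbeddedSolution F' T') (ht : t ∈ timeInterval T)
    (ht' : t ∈ timeInterval T')
    (h : Set.range (F' t) ⊆ enclosedRegion (Set.range (F t))) {p : N} {q : N'}
    (hmin : ∀ p' q', ‖F t p - F' t q‖ ≤ ‖F t p' - F' t q'‖) :
    ∃ c, 0 ≤ c ∧ HasDerivWithinAt (fun s => ‖F s p - F' s q‖ ^ 2) c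
      (timeInterval T ∩ timeInterval T') t := by
  have hyE : F' t q ∈ enclosedRegion (Set.range (F t)) := h ⟨q, rfl⟩
  have hne : F t p ≠ F' t q := fun he => hyE.1 ⟨p, he⟩
  have hxE : F t p ∉ enclosedRegion (Set.range (F' t)) := fun hx =>
    (hF.closure_enclosedRegion_subset hF' ht ht' h (subset_closure hx)).1 ⟨p, rfl⟩
  have hmin' : ∀ q', ‖F' t q - F t p‖ ≤ ‖F' t q' - F t p‖ := fun q' => by
    rw [norm_sub_rev, norm_sub_rev (F' t q')]; exact hmin p q'
  have hpos : 0 < ‖F t p - F' t q‖ := norm_pos_iff.2 (sub_ne_zero.2 hne)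
  obtain ⟨ν, hν, hH, hd, h1, -⟩ := hF.exists_normal_of_isMin ht hne fun p' => hmin p' q
  obtain ⟨ν', -, hH', hd', -, h2⟩ := hF'.exists_normal_of_isMin ht' hne.symm hmin'
  replace h1 := h1 hyE
  replace h2 := h2 hxE
  rw [neg_sub, norm_sub_rev] at h2
  -- The role of the nearby point is reversed twice, enclosed versus exterior and `x - y` versus `y
  -- - x`, so the two normals agree.
  obtain rfl : ν = ν' := smul_right_injective _ hpos.ne' (h1.trans h2.symm)
  have hle := meanCurvature_le_of_isMin (contMDiff_of_contMDiffOn_prod hF.smooth ht)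
    (contMDiff_of_contMDiffOn_prod hF'.smooth ht') (hF.immersion t ht p)
    (hF'.immersion t ht' q) hmin hne h1
  have hinv := inv_anti₀ hH hle
  refine ⟨_, ?_, ((hd.mono Set.inter_subset_left).sub
    (hd'.mono Set.inter_subset_right)).norm_sq⟩
  simp only [Pi.sub_apply]
  rw [← h1, ← sub_smul, inner_smul_left, inner_smul_right, real_inner_self_eq_norm_sq, hν]
  simp only [conj_trivial, mul_one, one_pow]
  have := mul_nonneg hpos.le (sub_nonneg.2 hinv)
  linarith

variable [CompactSpace N] [CompactSpace N'] [Nonempty N'] [Nonempty N]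

/-- The distance between two solutions does not decrease while one encloses the other. -/
theorem setDist_le_of_forall_subset (hF : IsEmbeddedSolution F T)
    (hF' : IsEmbeddedSolution F' T') {a b : ℝ} (hab : a ≤ b)
    (hI : Set.Icc a b ⊆ timeInterval T ∩ timeInterval T')
    (h : ∀ t ∈ Set.Icc a b, Set.range (F' t) ⊆ enclosedRegion (Set.range (F t))) :
    setDist (Set.range (F a)) (Set.range (F' a)) ≤
      setDist (Set.range (F b)) (Set.range (F' b)) := by
  set D : ℝ → ℝ := fun t => setDist (Set.range (F t)) (Set.range (F' t)) with hD
  have hD0 : ∀ t, 0 ≤ D t := fun t => Real.sInf_nonneg (by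
    rintro _ ⟨_, -, _, -, rfl⟩
    exact dist_nonneg)
  have hmaps : Set.MapsTo (fun s : ℝ => -s) (Set.Icc (-b) (-a)) (Set.Icc a b) := fun s hs =>
    ⟨by linarith [hs.2], by linarith [hs.1]⟩
  have hcont : ContinuousOn (fun s => D (-s) ^ 2) (Set.Icc (-b) (-a)) :=
    ((((hF.continuousOn_setDist hF').mono hI).comp continuous_neg.continuousOn hmaps)).pow 2
  -- The fixed-pair distance bounds `D` only from above, so it controls forward slopes only from
  -- above. Reversing time turns this into the required estimate: the right slopes of `D (-s) ^ 2`
  -- are eventually below any `r > 0`, and the constant barrier `D b ^ 2` applies.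
  have key := image_le_of_liminf_slope_right_le_deriv_boundary (f := fun s => D (-s) ^ 2)
    (B := fun _ => D b ^ 2) (B' := fun _ => 0) hcont (by simp) continuousOn_const
    (fun x _ => hasDerivWithinAt_const _ _ _) ?_ (x := -a) ⟨by linarith, le_rfl⟩
  · simp only [neg_neg] at key
    exact (pow_le_pow_iff_left₀ (hD0 a) (hD0 b) two_ne_zero).1 key
  intro x hx r hr
  have hxm := hmaps ⟨hx.1, hx.2.le⟩
  obtain ⟨hxT, hxT'⟩ := hI hxm
  obtain ⟨p, q, hpq, hmin⟩ := exists_pair_of_isEmbeddedSolution hF hF' hxT hxT'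
  obtain ⟨c, hc, hderiv⟩ := exists_hasDerivWithinAt_norm_sub_sq hF hF' hxT hxT' (h _ hxm) hmin
  have hneg : HasDerivWithinAt (fun s : ℝ => -s) (-1) (Set.Ioo x (-a)) x :=
    (hasDerivAt_neg x).hasDerivWithinAt
  have hcomp := HasDerivWithinAt.scomp x hderiv hneg fun s hs =>
    hI (hmaps ⟨hx.1.trans hs.1.le, hs.2.le⟩)
  rw [hasDerivWithinAt_iff_tendsto_slope' (by simp), nhdsWithin_Ioo_eq_nhdsGT hx.2] at hcomp
  have hlt : (-1 : ℝ) • c < r := by simp only [neg_smul, one_smul]; linarith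
  refine Filter.Eventually.frequently ?_
  filter_upwards [hcomp.eventually (gt_mem_nhds hlt), Ioo_mem_nhdsGT hx.2] with z hz hzI
  refine lt_of_le_of_lt ?_ hz
  rw [slope_def_field, slope_def_field]
  have hzx : 0 < z - x := sub_pos.2 hzI.1
  simp only [Function.comp_apply, hpq]
  gcongr
  · exact hD0 _
  · exact setDist_range_le p q

/-- A solution enclosed by another one at time `0` remains enclosed. -/
theorem range_subset_enclosedRegion [ConnectedSpace N'] (hF : IsEmbeddedSolution F T)
    (hF' : IsEmbeddedSolution F' T')
    (h0 : Set.range (F' 0) ⊆ enclosedRegion (Set.range (F 0)))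
    (ht : t ∈ timeInterval T) (ht' : t ∈ timeInterval T') :
    Set.range (F' t) ⊆ enclosedRegion (Set.range (F t)) := by
  set K := Set.Icc 0 t with hK
  have hKI : K ⊆ timeInterval T ∩ timeInterval T' := fun s hs =>
    ⟨ordConnected_timeInterval.out (zero_mem_timeInterval ht) ht hs,
      ordConnected_timeInterval.out (zero_mem_timeInterval ht') ht' hs⟩
  set D : ℝ → ℝ := fun t => setDist (Set.range (F t)) (Set.range (F' t)) with hD
  have hDc : ContinuousOn D K := (hF.continuousOn_setDist hF').mono hKI
  set f : (N × N') × ℝ → ℝ := fun x => ‖F x.2 x.1.1 - F' x.2 x.1.2‖ - D x.2 with hf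
  -- At a zero of `f`, that is, a closest pair, the sign of `φ` decides nesting whenever the
  -- distance is positive.
  set φ : (N × N') × ℝ → ℝ := fun x =>
    inner ℝ (derivWithin (fun s => F s x.1.1) (timeInterval T) x.2)
      (F x.2 x.1.1 - F' x.2 x.1.2) with hφ
  have c1 : ContinuousOn (fun x : (N × N') × ℝ => F x.2 x.1.1) (Set.univ ×ˢ K) :=
    hF.smooth.continuousOn.comp (f := fun x : (N × N') × ℝ => (x.1.1, x.2))
      (by fun_prop) fun x hx => ⟨trivial, (hKI hx.2).1⟩
  have c2 : ContinuousOn (fun x : (N × N') × ℝ => F' x.2 x.1.2) (Set.univ ×ˢ K) :=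
    hF'.smooth.continuousOn.comp (f := fun x : (N × N') × ℝ => (x.1.2, x.2))
      (by fun_prop) fun x hx => ⟨trivial, (hKI hx.2).2⟩
  have c3 : ContinuousOn (fun x : (N × N') × ℝ =>
      derivWithin (fun s => F s x.1.1) (timeInterval T) x.2) (Set.univ ×ˢ K) :=
    (continuousOn_derivWithin_of_contMDiffOn hF.smooth uniqueDiffOn_timeInterval).comp
      (f := fun x : (N × N') × ℝ => (x.1.1, x.2))
      (by fun_prop) fun x hx => ⟨trivial, (hKI hx.2).1⟩
  have c4 : ContinuousOn (fun x : (N × N') × ℝ => D x.2) (Set.univ ×ˢ K) :=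
    hDc.comp continuousOn_snd fun x hx => hx.2
  have hfc : ContinuousOn f (Set.univ ×ˢ K) := (c1.sub c2).norm.sub c4
  have hφc : ContinuousOn φ (Set.univ ×ˢ K) := c3.inner (𝕜 := ℝ) (c1.sub c2)
  have hminOf : ∀ {s : ℝ} {x : N × N'}, f (x, s) = 0 →
      ∀ p' q', ‖F s x.1 - F' s x.2‖ ≤ ‖F s p' - F' s q'‖ := by
    intro s x hx p' q'
    rw [sub_eq_zero.1 hx]
    exact setDist_range_le p' q'
  have hpair : ∀ s ∈ K, ∃ x, f (x, s) = 0 := by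
    intro s hs
    obtain ⟨p, q, h, -⟩ := exists_pair_of_isEmbeddedSolution hF hF' (hKI hs).1 (hKI hs).2
    exact ⟨(p, q), sub_eq_zero.2 h⟩
  have hgood : ∀ s ∈ K, Set.range (F' s) ⊆ enclosedRegion (Set.range (F s)) →
      ∀ x, f (x, s) = 0 → 0 < D s ∧ 0 < φ (x, s) := by
    intro s hs h x hx
    have hyE := h ⟨x.2, rfl⟩
    have hne : F s x.1 ≠ F' s x.2 := fun he => hyE.1 ⟨x.1, he⟩
    refine ⟨?_, (hF.inner_velocity_of_isMin (hKI hs).1 hne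
      fun p' => hminOf hx p' x.2).1 hyE⟩
    rw [← sub_eq_zero.1 hx]
    exact norm_pos_iff.2 (sub_ne_zero.2 hne)
  have hbad : ∀ s ∈ K, ¬ Set.range (F' s) ⊆ enclosedRegion (Set.range (F s)) → 0 < D s →
      ∀ x, f (x, s) = 0 → φ (x, s) < 0 := by
    intro s hs h hDs x hx
    have hne : F s x.1 ≠ F' s x.2 := by
      rw [← sub_eq_zero.1 hx] at hDs
      exact sub_ne_zero.1 (norm_pos_iff.1 hDs)
    refine (hF.inner_velocity_of_isMin (hKI hs).1 hne fun p' => hminOf hx p' x.2).2 fun hyE => h ?_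
    exact range_subset_enclosedRegion_of_mem hF' (hKI hs).2 hne (hminOf hx) hyE
  set B := {s | s ∈ K ∧ ¬ Set.range (F' s) ⊆ enclosedRegion (Set.range (F s))} with hB
  have hBclosed : IsClosed B := by
    convert isClosed_setOf_exists_eq_zero_and_nonneg isCompact_Icc hfc hφc.neg using 1
    ext s
    constructor
    · rintro ⟨hs, h⟩
      obtain ⟨x, hx⟩ := hpair s hs
      refine ⟨hs, x, hx, ?_⟩
      have hDs : 0 ≤ D s := by rw [← sub_eq_zero.1 hx]; exact norm_nonneg _
      -- When the surfaces touch, `φ = 0` at a closest pair, so the non-strict inequality covers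
      -- this case too.
      rcases hDs.eq_or_lt with h0 | hpos
      · have : F s x.1 - F' s x.2 = 0 := by
          rw [← norm_eq_zero, h0]; exact sub_eq_zero.1 hx
        simp [hφ, this]
      · exact neg_nonneg.2 (hbad s hs h hpos x hx).le
    · rintro ⟨hs, x, hx, hφx⟩
      exact ⟨hs, fun h => absurd (hgood s hs h x hx).2 (not_lt.2 (neg_nonneg.1 hφx))⟩
  by_contra hcon
  have hBne : B.Nonempty := ⟨t, ⟨ht.1, le_rfl⟩, hcon⟩
  have hBbdd : BddBelow B := ⟨0, fun s hs => hs.1.1⟩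
  set τ := sInf B with hτ
  obtain ⟨hτK, hτbad⟩ : τ ∈ B := hBclosed.csInf_mem hBne hBbdd
  have hτpos : 0 < τ := hτK.1.lt_of_ne fun h => hτbad (h ▸ h0)
  have hbefore : ∀ s ∈ Set.Ico 0 τ, Set.range (F' s) ⊆ enclosedRegion (Set.range (F s)) := by
    intro s hs
    by_contra h
    exact absurd (csInf_le hBbdd ⟨⟨hs.1, hs.2.le.trans hτK.2⟩, h⟩) (not_le.2 hs.2)
  have hsubK : Set.Ico 0 τ ⊆ K := fun s hs => ⟨hs.1, hs.2.le.trans hτK.2⟩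
  have hτcl : ∀ {Z : Set ℝ}, IsClosed Z → Set.Ico 0 τ ⊆ Z → τ ∈ Z := by
    intro Z hZ hsub
    have := closure_minimal hsub hZ
    rw [closure_Ico hτpos.ne] at this
    exact this ⟨hτpos.le, le_rfl⟩
  have hD0 : 0 < D 0 := by
    have h0K : (0 : ℝ) ∈ K := ⟨le_rfl, ht.1⟩
    obtain ⟨x, hx⟩ := hpair 0 h0K
    exact (hgood 0 h0K h0 x hx).1
  have hDτ : D 0 ≤ D τ := by
    -- Monotonicity is available on each `[0, s]` with `s < τ`; continuity of `D` carries the bound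
    -- to `τ` and rules out first contact.
    refine (hτcl (hDc.preimage_isClosed_of_isClosed isClosed_Icc (isClosed_Ici (a := D 0)))
      fun s hs => ⟨hsubK hs, ?_⟩).2
    refine setDist_le_of_forall_subset hF hF' hs.1 (fun r hr => hKI ⟨hr.1, ?_⟩)
      fun r hr => hbefore r ⟨hr.1, hr.2.trans_lt hs.2⟩
    exact (hr.2.trans hs.2.le).trans hτK.2
  -- Closest pairs at nested times have `φ > 0`; in the limit some closest pair at `τ` has `φ ≥ 0`,
  -- against `hbad`.
  obtain ⟨-, x, hx, hφx⟩ := hτcl (isClosed_setOf_exists_eq_zero_and_nonneg isCompact_Icc hfc hφc)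
    fun s hs => by
      obtain ⟨x, hx⟩ := hpair s (hsubK hs)
      exact ⟨hsubK hs, x, hx, (hgood s (hsubK hs) (hbefore s hs) x hx).2.le⟩
  exact absurd hφx (not_le.2 (hbad τ hτK hτbad (hD0.trans_le hDτ) x hx))

end Flow

end IMCF

end

theorem theorem3 {n : ℕ}
    {N : Type*} [TopologicalSpace N] [ChartedSpace (EuclideanSpace ℝ (Fin n)) N]
    [IsManifold (𝓡 n) ∞ N] [T2Space N] [CompactSpace N] [ConnectedSpace N]
    {N' : Type*} [TopologicalSpace N'] [ChartedSpace (EuclideanSpace ℝ (Fin n)) N']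
    [IsManifold (𝓡 n) ∞ N'] [T2Space N'] [CompactSpace N'] [ConnectedSpace N']
    {T T' : EReal}
    {F : ℝ → N → EuclideanSpace ℝ (Fin (n + 1))}
    {F' : ℝ → N' → EuclideanSpace ℝ (Fin (n + 1))}
    (hF : IMCF.IsEmbeddedSolution F T) (hF' : IMCF.IsEmbeddedSolution F' T')
    (h0 : Set.range (F' 0) ⊆ IMCF.enclosedRegion (Set.range (F 0))) :
    (∀ t ∈ IMCF.timeInterval T ∩ IMCF.timeInterval T',
      closure (IMCF.enclosedRegion (Set.range (F' t))) ⊆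
        IMCF.enclosedRegion (Set.range (F t))) ∧
    MonotoneOn (fun t => IMCF.setDist (Set.range (F t)) (Set.range (F' t)))
      (IMCF.timeInterval T ∩ IMCF.timeInterval T') := by
  refine ⟨fun t ht => hF.closure_enclosedRegion_subset hF' ht.1 ht.2
    (IMCF.range_subset_enclosedRegion hF hF' h0 ht.1 ht.2), fun a ha b hb hab => ?_⟩
  have hI : Set.Icc a b ⊆ IMCF.timeInterval T ∩ IMCF.timeInterval T' := fun s hs =>
    ⟨IMCF.ordConnected_timeInterval.out ha.1 hb.1 hs,
      IMCF.ordConnected_timeInterval.out ha.2 hb.2 hs⟩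
  exact IMCF.setDist_le_of_forall_subset hF hF' hab hI fun t ht =>
    IMCF.range_subset_enclosedRegion hF hF' h0 (hI ht).1 (hI ht).2
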